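/- **Setting.** Fix real numbers $F\ge 1$, $K\ge 0$, $G\ge 1$, $H\ge 2$. A seminorm defined on a subspace is given the value $\infty$ off that subspace (its domain is where it is finite), and $\Re b=\frac{b+b^*}{2}$, $\Im b=\frac{b-b^*}{2i}$. C*-algebras, representations and $*$-morphisms are unital; $\mathscr S(\mathfrak A)$ is the state space of $\mathfrak A$. *Quantum compact metric spaces.* $(\mathfrak A,L)$ is a quantum compact metric space if $L$ is a seminorm on a dense subspace of the self-adjoint part of $\mathfrak A$ with $L(1)=0$, $\{L\le 1\}$ closed, $\max\{L(\Re(ab)),L(\Im(ab))\}\le F(L(a)\|b\|+\|a\|L(b))+KL(a)L(b)$ for $a,b\in\mathrm{dom}\,L$, and such that $\mathsf{mk}_L(\varphi,\psi)=\sup\{|\varphi(a)-\psi(a)|:L(a)\le1\}$ is a metric inducing the weak* topology on $\mathscr S(\mathfrak A)$. *Metrical C*-correspondences.* $(M,\mathsf D,\mathfrak A,L,\mathfrak B,S)$ consists of quantum compact metric spaces $(\mathfrak A,L)$ and $(\mathfrak B,S)$, a right Hilbert $\mathfrak B$-module $M$ with a $*$-morphism from $\mathfrak A$ to the adjointable operators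 of $M$, and a norm $\mathsf D\ge\|\cdot\|_M$ on a dense subspace of $M$ with $\{\mathsf D\le1\}$ compact in $M$, $\mathsf D(a\omega)\le G(\|a\|+L(a))\mathsf D(\omega)$ for $a\in\mathrm{dom}\,L$, $\omega\in\mathrm{dom}\,\mathsf D$, and $\max\{S(\Re\langle\omega,\eta\rangle),S(\Im\langle\omega,\eta\rangle)\}\le H\,\mathsf D(\omega)\mathsf D(\eta)$ for $\omega,\eta\in\mathrm{dom}\,\mathsf D$. A modular quantum isometry $(\Pi,\pi,\theta)$ between two of them consists of a continuous linear map $\Pi$ of the modules and $*$-morphisms $\pi,\theta$ of the left and right algebras, intertwining the actions and the inner products and mapping the domains of the (semi)norms into each other, such that each of the three (semi)norms of the codomain is, on its domain, the quotient of the corresponding one of the domain (the infimum over preimages). *Metric spectral triples.* A spectral triple $(\mathfrak A,\mathcal H,D)$ is a C*-algebra $\mathfrak A$ represented on a Hilbert space $\mathcal H$ with a self-adjoint operator $D$ such that $D+i$ has a compact inverse and the self-adjoint $a$ with $a\,\mathrm{dom}\,D\subseteq\mathrm{dom}\,D$ and $[D,a]$ bounded are dense among the self-adjoint elements. Let $L_D(a)=\|[D,a]\|$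 for these $a$. The triple is *metric* if $(\mathfrak A,L_D)$ is a quantum compact metric space. Let $\mathsf D_D(\xi)=\|\xi\|+\|D\xi\|$ on $\mathrm{dom}\,D$. *Spectral propinquity.* A tunnel $\tau$ between metric spectral triples $(\mathfrak A_k,\mathcal H_k,D_k)$, $k=1,2$, is a metrical C*-correspondence $P=(M,\mathsf D,\mathfrak D,L,\mathfrak E,S)$ with modular quantum isometries $(\Pi_k,\pi_k,\theta_k)$ from $P$ to $(\mathcal H_k,\mathsf D_{D_k},\mathfrak A_k,L_{D_k},\mathbb C,0)$. Its extent is the largest of the Hausdorff distances, for $k=1,2$, between $\{\varphi\circ\pi_k:\varphi\in\mathscr S(\mathfrak A_k)\}$ and $\mathscr S(\mathfrak D)$ for $\mathsf{mk}_L$, and between $\{\psi\circ\theta_k:\psi\in\mathscr S(\mathbb C)\}$ and $\mathscr S(\mathfrak E)$ for $\mathsf{mk}_S$. For $\varepsilon>0$, an $\varepsilon$-iso-iso is a pair of maps $\varsigma_1,\varsigma_2:[0,\infty)\to[0,\infty)$ with $\varsigma_1(0)=\varsigma_2(0)=0$ and $\big||\varsigma_j(x)+\varsigma_j(y)-z|-|x+y-\varsigma_k(z)|\big|<\varepsilon$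 for all $x,y,z\in[0,1/\varepsilon]$ and $\{j,k\}=\{1,2\}$. The $\varepsilon$-reach of $(\tau,\varsigma_1,\varsigma_2)$ is $$\max_{\{j,k\}=\{1,2\}}\ \sup_{\mathsf D_{D_j}(\xi)\le1}\ \inf_{\mathsf D_{D_k}(\eta)\le1}\ \sup_{0\le t\le1/\varepsilon}\ \sup_{\mathsf D(\omega)\le1}\left|\langle e^{-itD_j}\xi,\Pi_j\omega\rangle-\langle e^{-i\varsigma_j(t)D_k}\eta,\Pi_k\omega\rangle\right| .$$ The spectral propinquity of the two triples is the infimum of $\frac{\sqrt2}{2}$ and of all $\varepsilon>0$ for which some tunnel $\tau$ and some $\varepsilon$-iso-iso have both the extent of $\tau$ and the $\varepsilon$-reach less than $\varepsilon$. **Statement.** Let $(\mathfrak A_n,\mathcal H_n,D_n)_{n\in\mathbb N}$ be metric spectral triples that converge, for the spectral propinquity, to a metric spectral triple $(\mathfrak A_\infty,\mathcal H_\infty,D_\infty)$. For each $n\in\mathbb N\cup\{\infty\}$ assume that the spectrum of $D_n$ is written $\sigma(D_n)=\{\lambda_n^j:j\in Y_n\}$, where $Y_n$ is an interval of $\mathbb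 Z$ containing $0$, $\lambda_n^j$ is strictly increasing in $j\in Y_n$, and $\lambda_n^0=\min\big(\sigma(D_n)\cap[0,\infty)\big)$. Suppose there is a family $(\delta_j)_{j\in\mathbb Z}$ in $(0,\infty)$ such that $\lambda_n^{j+1}-\lambda_n^j>\delta_j$ for all $n\in\mathbb N$ and all $j$ with $j,j+1\in Y_n$. Then: 1. If $0\notin\sigma(D_\infty)$, then for every $j\in Y_\infty$ we have $j\in Y_n$ for all large $n$ and $\lim_{n\to\infty}\lambda_n^j=\lambda_\infty^j$. 2. If $0\in\sigma(D_\infty)$, then $\lambda_\infty^0=0$, and there are $s_n\in\{0,1\}$ ($n\in\mathbb N$) such that for every $j\in Y_\infty$ we have $j-s_n\in Y_n$ for all large $n$ and $\lim_{n\to\infty}\lambda_n^{j-s_n}=\lambda_\infty^j$. Moreover, if $\lambda_n^0\to0$, then for every $j\in Y_\infty$ we have $j\in Y_n$ for all large $n$ and $\lim_{n\to\infty}\lambda_n^{j}=\lambda_\infty^j$; and if $-1\in Y_n$ for all large $n$ and $\lambda_n^{-1}\to0$, then for every $j\in Y_\infty$ we have $j-1\in Y_n$ for all large $n$ and $\lim_{n\to\infty}\lambda_n^{j-1}=\lambda_\infty^j$.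 -/

import Mathlib

open Filter Topology
open scoped ENNReal NNReal ComplexStarModule

universe u v w

noncomputable section

namespace SpectralPropinquity

/-! ### Quantum compact metric spaces -/

/-- The state space of a unital C*-algebra, inside the dual with its weak* topology. -/
def StateSpace (A : Type u) [CStarAlgebra A] : Set (WeakDual ℂ A) :=
  {φ | φ 1 = 1 ∧ ∀ a : A, 0 ≤ (φ (star a * a)).re ∧ (φ (star a * a)).im = 0}

/-- The Monge-Kantorovich distance of `L`. A seminorm defined on a subspace is encoded by its
extension with the value `∞` off that subspace. -/
def mongeKantorovich {A : Type u} [CStarAlgebra A] (L : A → ℝ≥0∞) (φ ψ : WeakDual ℂ A) : ℝ≥0∞ :=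
  ⨆ (a : A) (_ : L a ≤ 1), ‖φ a - ψ a‖ₑ

/-- `(A, L)` is an `(F, K)`-quantum compact metric space. -/
structure IsQuantumCompactMetric (F K : ℝ) {A : Type u} [CStarAlgebra A] (L : A → ℝ≥0∞) :
    Prop where
  isSelfAdjoint_of_ne_top : ∀ a, L a ≠ ∞ → IsSelfAdjoint a
  smul : ∀ (t : ℝ) (a : A), L (t • a) = ‖t‖ₑ * L a
  add_le : ∀ a b : A, L (a + b) ≤ L a + L b
  dense_dom : ∀ a : A, IsSelfAdjoint a → a ∈ closure {b : A | L b ≠ ∞}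
  one : L 1 = 0
  /-- The Monge-Kantorovich distance is a (finite, separating) metric on the state space. -/
  dist_ne_top : ∀ φ ∈ StateSpace A, ∀ ψ ∈ StateSpace A, mongeKantorovich L φ ψ ≠ ∞
  eq_of_dist_eq_zero : ∀ φ ∈ StateSpace A, ∀ ψ ∈ StateSpace A,
    mongeKantorovich L φ ψ = 0 → φ = ψ
  /-- The topology of that metric is the weak* topology of the state space. -/
  isOpen_iff : ∀ V : Set (StateSpace A), IsOpen V ↔
    ∀ φ ∈ V, ∃ ε : ℝ≥0∞, 0 < ε ∧ ∀ ψ : StateSpace A, mongeKantorovich L φ ψ < ε → ψ ∈ V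
  leibniz : ∀ a b : A, L a ≠ ∞ → L b ≠ ∞ →
    max (L (ℜ (a * b) : A)) (L (ℑ (a * b) : A)) ≤
      ENNReal.ofReal F * (L a * ‖b‖ₑ + ‖a‖ₑ * L b) + ENNReal.ofReal K * L a * L b
  isClosed_ball : IsClosed {a : A | L a ≤ 1}

/-! ### Metrical C*-correspondences -/

/-- An `A`-`B` C*-correspondence `M` (a right Hilbert C*-module over `B`, with a unital
*-morphism from `A` to the adjointable operators of `M`), together with extended-valued functions
`DN` on `M`, `L` on `A` and `S` on `B`. -/
structure CorrespondenceData where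
  M : Type u
  A : Type v
  B : Type w
  [cstarA : CStarAlgebra A]
  [cstarB : CStarAlgebra B]
  [normedM : NormedAddCommGroup M]
  [normedSpaceM : NormedSpace ℂ M]
  [completeM : CompleteSpace M]
  /-- The right action of `B`. -/
  rsmul : M →ₗ[ℂ] B →ₗ[ℂ] M
  rsmul_one : ∀ ω, rsmul ω 1 = ω
  rsmul_mul : ∀ ω b c, rsmul ω (b * c) = rsmul (rsmul ω b) c
  /-- The `B`-valued inner product, linear in the second variable. -/
  ip : M → M → B
  ip_add_right : ∀ ω η ζ, ip ω (η + ζ) = ip ω η + ip ω ζ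
  ip_smul_right : ∀ (z : ℂ) (ω η), ip ω (z • η) = z • ip ω η
  ip_rsmul_right : ∀ ω η b, ip ω (rsmul η b) = ip ω η * b
  star_ip : ∀ ω η, star (ip η ω) = ip ω η
  ip_self_nonneg : ∀ ω, ∃ b : B, ip ω ω = star b * b
  ip_self_eq_zero : ∀ ω, ip ω ω = 0 ↔ ω = 0
  norm_eq : ∀ ω, ‖ω‖ = √‖ip ω ω‖
  /-- The left action of `A`. -/
  act : A →ₐ[ℂ] Module.End ℂ M
  act_rsmul : ∀ a ω b, act a (rsmul ω b) = rsmul (act a ω) b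
  ip_act : ∀ a ω η, ip (act a ω) η = ip ω (act (star a) η)
  DN : M → ℝ≥0∞
  L : A → ℝ≥0∞
  S : B → ℝ≥0∞

attribute [instance] CorrespondenceData.cstarA CorrespondenceData.cstarB
  CorrespondenceData.normedM CorrespondenceData.normedSpaceM CorrespondenceData.completeM

/-- The data form an `(F, K, G, H)`-metrical C*-correspondence, with D-norm `DN`. -/
structure CorrespondenceData.IsMetrical (F K G H : ℝ) (P : CorrespondenceData.{u, v, w}) :
    Prop where
  left : IsQuantumCompactMetric F K P.L
  right : IsQuantumCompactMetric F K P.S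
  smul : ∀ (z : ℂ) (ω : P.M), P.DN (z • ω) = ‖z‖ₑ * P.DN ω
  add_le : ∀ ω η : P.M, P.DN (ω + η) ≤ P.DN ω + P.DN η
  dense_dom : Dense {ω : P.M | P.DN ω ≠ ∞}
  norm_le : ∀ ω : P.M, ‖ω‖ₑ ≤ P.DN ω
  isCompact_ball : IsCompact {ω : P.M | P.DN ω ≤ 1}
  modular_leibniz : ∀ (a : P.A) (ω : P.M), P.L a ≠ ∞ → P.DN ω ≠ ∞ →
    P.DN (P.act a ω) ≤ ENNReal.ofReal G * (‖a‖ₑ + P.L a) * P.DN ω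
  inner_leibniz : ∀ ω η : P.M, P.DN ω ≠ ∞ → P.DN η ≠ ∞ →
    max (P.S (ℜ (P.ip ω η) : P.B)) (P.S (ℑ (P.ip ω η) : P.B)) ≤
      ENNReal.ofReal H * P.DN ω * P.DN η

/-- A modular quantum isometry: a Lipschitz morphism such that the three extended (semi)norms of
the codomain are the quotients of those of the domain. -/
structure ModularQuantumIsometry (P : CorrespondenceData.{w, w, w})
    (Q : CorrespondenceData.{v, u, 0}) where
  modMap : P.M →L[ℂ] Q.M
  leftMap : P.A →⋆ₐ[ℂ] Q.A
  rightMap : P.B →⋆ₐ[ℂ] Q.B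
  map_act : ∀ a ω, modMap (P.act a ω) = Q.act (leftMap a) (modMap ω)
  map_rsmul : ∀ ω b, modMap (P.rsmul ω b) = Q.rsmul (modMap ω) (rightMap b)
  map_ip : ∀ ω η, rightMap (P.ip ω η) = Q.ip (modMap ω) (modMap η)
  map_dom_L : ∀ a, P.L a ≠ ∞ → Q.L (leftMap a) ≠ ∞
  map_dom_S : ∀ b, P.S b ≠ ∞ → Q.S (rightMap b) ≠ ∞
  map_dom_DN : ∀ ω, P.DN ω ≠ ∞ → Q.DN (modMap ω) ≠ ∞
  quotient_L : ∀ a, Q.L a ≠ ∞ → Q.L a = ⨅ (d : P.A) (_ : leftMap d = a), P.L d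
  quotient_S : ∀ b, Q.S b ≠ ∞ → Q.S b = ⨅ (d : P.B) (_ : rightMap d = b), P.S d
  quotient_DN : ∀ ω, Q.DN ω ≠ ∞ → Q.DN ω = ⨅ (η : P.M) (_ : modMap η = ω), P.DN η

/-- A metrical tunnel, within the class of `(F, K, G, H)`-metrical C*-correspondences. -/
structure Tunnel (F K G H : ℝ) (Q₁ Q₂ : CorrespondenceData.{v, u, 0}) where
  P : CorrespondenceData.{w, w, w}
  isMetrical : P.IsMetrical F K G H
  fst : ModularQuantumIsometry P Q₁
  snd : ModularQuantumIsometry P Q₂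

/-- The reversed tunnel. -/
def Tunnel.symm {F K G H : ℝ} {Q₁ Q₂ : CorrespondenceData.{v, u, 0}}
    (τ : Tunnel.{u, v, w} F K G H Q₁ Q₂) : Tunnel.{u, v, w} F K G H Q₂ Q₁ :=
  ⟨τ.P, τ.isMetrical, τ.snd, τ.fst⟩

/-- The directed Hausdorff distance `sup_{x ∈ X} inf_{y ∈ Y} d x y`. -/
def directedHausdorff {α β : Type*} (d : α → β → ℝ≥0∞) (X : Set α) (Y : Set β) : ℝ≥0∞ :=
  ⨆ x ∈ X, ⨅ y ∈ Y, d x y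

/-- The Hausdorff distance of two sets for the distance function `d`. -/
def hausdorff {α : Type*} (d : α → α → ℝ≥0∞) (X Y : Set α) : ℝ≥0∞ :=
  max (directedHausdorff d X Y) (directedHausdorff d Y X)

/-- The set `{φ ∘ π : φ ∈ S(A)}` of states of `D`. -/
def pulledBackStates {D : Type w} {A : Type u} [CStarAlgebra D] [CStarAlgebra A]
    (π : D →⋆ₐ[ℂ] A) : Set (WeakDual ℂ D) :=
  {ψ | ∃ φ ∈ StateSpace A, ∀ d, ψ d = φ (π d)}

/-- The extent of a tunnel. -/
def Tunnel.extent {F K G H : ℝ} {Q₁ Q₂ : CorrespondenceData.{v, u, 0}}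
    (τ : Tunnel.{u, v, w} F K G H Q₁ Q₂) : ℝ≥0∞ :=
  max
    (max (hausdorff (mongeKantorovich τ.P.L) (pulledBackStates τ.fst.leftMap) (StateSpace τ.P.A))
      (hausdorff (mongeKantorovich τ.P.S) (pulledBackStates τ.fst.rightMap) (StateSpace τ.P.B)))
    (max (hausdorff (mongeKantorovich τ.P.L) (pulledBackStates τ.snd.leftMap) (StateSpace τ.P.A))
      (hausdorff (mongeKantorovich τ.P.S) (pulledBackStates τ.snd.rightMap) (StateSpace τ.P.B)))

/-! ### Unbounded operators and spectral triples -/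

/-- `R` is a bounded everywhere defined inverse of `D - z`. -/
def IsResolventAt {H : Type v} [NormedAddCommGroup H] [InnerProductSpace ℂ H]
    (D : H →ₗ.[ℂ] H) (z : ℂ) (R : H →L[ℂ] H) : Prop :=
  (∀ x : H, ∃ h : R x ∈ D.domain, D ⟨R x, h⟩ - z • R x = x) ∧
    ∀ x : D.domain, R (D x - z • (x : H)) = x

/-- The spectrum of an unbounded operator. -/
def opSpectrum {H : Type v} [NormedAddCommGroup H] [InnerProductSpace ℂ H]
    (D : H →ₗ.[ℂ] H) : Set ℂ :=
  {z | ¬ ∃ R : H →L[ℂ] H, IsResolventAt D z R}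

/-- `U` is the group `t ↦ exp (i t D)`: the strongly continuous one-parameter group of unitaries
whose generator is the self-adjoint operator `D` (it is unique by Stone's theorem, because a
self-adjoint operator has no proper self-adjoint extension). -/
structure IsUnitaryGroup {H : Type v} [NormedAddCommGroup H] [InnerProductSpace ℂ H]
    (D : H →ₗ.[ℂ] H) (U : ℝ → H ≃ₗᵢ[ℂ] H) : Prop where
  zero : ∀ ξ, U 0 ξ = ξ
  add : ∀ s t ξ, U (s + t) ξ = U s (U t ξ)
  continuous : ∀ ξ, Continuous fun t => U t ξ
  generator : ∀ ξ : D.domain, HasDerivAt (fun t : ℝ => U t (ξ : H)) (Complex.I • D ξ) 0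

/-- The Lipschitz seminorm `a ↦ ‖[D, a]‖` of a represented C*-algebra, on the self-adjoint `a`
which preserve the domain of `D` and have a bounded commutator with it; `∞` elsewhere. -/
def diracLip {A : Type u} {H : Type v} [CStarAlgebra A] [NormedAddCommGroup H]
    [InnerProductSpace ℂ H] [CompleteSpace H] (rep : A →⋆ₐ[ℂ] (H →L[ℂ] H)) (D : H →ₗ.[ℂ] H)
    (a : A) : ℝ≥0∞ :=
  open Classical in
  if h : IsSelfAdjoint a ∧ ∀ ξ : D.domain, rep a (ξ : H) ∈ D.domain then
    ⨆ (ξ : D.domain) (_ : ‖(ξ : H)‖ ≤ 1), ‖D ⟨rep a (ξ : H), h.2 ξ⟩ - rep a (D ξ)‖ₑ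
  else ∞

/-- The graph norm `‖ξ‖ + ‖D ξ‖` on the domain of `D`; `∞` elsewhere. -/
def graphNorm {H : Type v} [NormedAddCommGroup H] [InnerProductSpace ℂ H] (D : H →ₗ.[ℂ] H)
    (ξ : H) : ℝ≥0∞ :=
  open Classical in
  if h : ξ ∈ D.domain then ‖ξ‖ₑ + ‖D ⟨ξ, h⟩‖ₑ else ∞

/-- A spectral triple `(A, H, D)`. -/
structure SpectralTriple where
  A : Type u
  H : Type v
  [cstarA : CStarAlgebra A]
  [normedH : NormedAddCommGroup H]
  [innerH : InnerProductSpace ℂ H]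
  [completeH : CompleteSpace H]
  rep : A →⋆ₐ[ℂ] (H →L[ℂ] H)
  D : H →ₗ.[ℂ] H
  dense_domain : Dense (D.domain : Set H)
  isSelfAdjoint : IsSelfAdjoint D
  compact_resolvent : ∃ R : H →L[ℂ] H, IsResolventAt D (-Complex.I) R ∧ IsCompactOperator R
  dense_lip : ∀ a : A, IsSelfAdjoint a → a ∈ closure {b : A | diracLip rep D b ≠ ∞}

attribute [instance] SpectralTriple.cstarA SpectralTriple.normedH SpectralTriple.innerH
  SpectralTriple.completeH

/-- A spectral triple is metric when `(A, ‖[D, ·]‖)` is a quantum compact metric space. -/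
def SpectralTriple.IsMetric (F K : ℝ) (T : SpectralTriple.{u, v}) : Prop :=
  IsQuantumCompactMetric F K (diracLip T.rep T.D)

/-- The data `(H, graph norm, A, ‖[D, ·]‖, ℂ, 0)` associated with a spectral triple. -/
def SpectralTriple.mcc (T : SpectralTriple.{u, v}) : CorrespondenceData.{v, u, 0} where
  M := T.H
  A := T.A
  B := ℂ
  rsmul := (LinearMap.lsmul ℂ T.H).flip
  rsmul_one := fun ω => by simp
  rsmul_mul := fun ω b c => by simp [smul_smul, mul_comm]
  ip := fun ξ η => inner ℂ ξ η
  ip_add_right := fun _ _ _ => inner_add_right _ _ _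
  ip_smul_right := fun z ω η => by simp
  ip_rsmul_right := fun ω η b => by simp [mul_comm]
  star_ip := fun ω η => inner_conj_symm ω η
  ip_self_nonneg := fun ω => ⟨(‖ω‖ : ℂ), by
    rw [inner_self_eq_norm_sq_to_K]; simp [sq]⟩
  ip_self_eq_zero := fun ω => inner_self_eq_zero
  norm_eq := fun ω => by
    rw [inner_self_eq_norm_sq_to_K]; simp
  act :=
    { toFun := fun a => (T.rep a : T.H →ₗ[ℂ] T.H)
      map_one' := by rw [map_one]; rfl
      map_mul' := fun a b => by rw [map_mul]; rfl
      map_zero' := by rw [map_zero]; rfl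
      map_add' := fun a b => by rw [map_add]; rfl
      commutes' := fun z => by rw [AlgHomClass.commutes]; rfl }
  act_rsmul := fun a ω b => map_smul (T.rep a) b ω
  ip_act := fun a ω η => by
    have h : T.rep (star a) = ContinuousLinearMap.adjoint (T.rep a) := by
      rw [map_star]; rfl
    change inner ℂ (T.rep a ω) η = inner ℂ ω (T.rep (star a) η)
    rw [h, ContinuousLinearMap.adjoint_inner_right]
  DN := graphNorm T.D
  L := diracLip T.rep T.D
  S := fun z => open Classical in if z.im = 0 then 0 else ∞

/-! ### The spectral propinquity -/

/-- `(ς₁, ς₂)` is an `ε`-iso-iso of the monoid `[0, ∞)`. -/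
def IsIsoIso (ε : ℝ) (ς₁ ς₂ : ℝ≥0 → ℝ≥0) : Prop :=
  ς₁ 0 = 0 ∧ ς₂ 0 = 0 ∧
    ∀ x y z : ℝ≥0, (x : ℝ) ≤ 1 / ε → (y : ℝ) ≤ 1 / ε → (z : ℝ) ≤ 1 / ε →
      |(|(ς₁ x : ℝ) + ς₁ y - z| - |(x : ℝ) + y - ς₂ z|)| < ε ∧
      |(|(ς₂ x : ℝ) + ς₂ y - z| - |(x : ℝ) + y - ς₁ z|)| < ε

/-- The half reach of a tunnel between two spectral triples: the directed Hausdorff distance from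
the families `(⟨U₁^{-t} ξ, Π₁ ·⟩)_{0 ≤ t ≤ 1/ε}` to the families
`(⟨U₂^{-ς t} η, Π₂ ·⟩)_{0 ≤ t ≤ 1/ε}`, where `ξ`, `η` range over the unit balls of the graph norms
and families are compared by the supremum over `t` of the Kantorovich distance of the D-norm. -/
def halfReach {F K G H : ℝ} {T₁ T₂ : SpectralTriple.{u, v}}
    (τ : Tunnel.{u, v, w} F K G H T₁.mcc T₂.mcc)
    (U₁ : ℝ → T₁.H ≃ₗᵢ[ℂ] T₁.H) (U₂ : ℝ → T₂.H ≃ₗᵢ[ℂ] T₂.H)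
    (ε : ℝ) (ς : ℝ≥0 → ℝ≥0) : ℝ≥0∞ :=
  directedHausdorff
    (fun (ξ : T₁.H) (η : T₂.H) =>
      ⨆ (t : ℝ≥0) (_ : (t : ℝ) ≤ 1 / ε) (ω : τ.P.M) (_ : τ.P.DN ω ≤ 1),
        ‖inner ℂ (U₁ (-(t : ℝ)) ξ) (τ.fst.modMap ω : T₁.H) -
          inner ℂ (U₂ (-(ς t : ℝ)) η) (τ.snd.modMap ω : T₂.H)‖ₑ)
    {ξ | graphNorm T₁.D ξ ≤ 1} {η | graphNorm T₂.D η ≤ 1}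

/-- The `ε`-magnitude of a tunnel and a pair of maps: the maximum of extent and `ε`-reach. -/
def magnitude {F K G H : ℝ} {T₁ T₂ : SpectralTriple.{u, v}}
    (τ : Tunnel.{u, v, w} F K G H T₁.mcc T₂.mcc)
    (U₁ : ℝ → T₁.H ≃ₗᵢ[ℂ] T₁.H) (U₂ : ℝ → T₂.H ≃ₗᵢ[ℂ] T₂.H)
    (ε : ℝ) (ς₁ ς₂ : ℝ≥0 → ℝ≥0) : ℝ≥0∞ :=
  max τ.extent (max (halfReach τ U₁ U₂ ε ς₁) (halfReach τ.symm U₂ U₁ ε ς₂))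

/-- The spectral propinquity: the infimum of `√2 / 2` and of all `ε > 0` such that some tunnel and
some `ε`-iso-iso have `ε`-magnitude less than `ε`. -/
def spectralPropinquity (F K G H : ℝ) (T₁ T₂ : SpectralTriple.{u, v}) : ℝ :=
  sInf {ε : ℝ | ε = √2 / 2 ∨ (0 < ε ∧
    ∃ (U₁ : ℝ → T₁.H ≃ₗᵢ[ℂ] T₁.H) (U₂ : ℝ → T₂.H ≃ₗᵢ[ℂ] T₂.H)
      (τ : Tunnel.{u, v, w} F K G H T₁.mcc T₂.mcc) (ς₁ ς₂ : ℝ≥0 → ℝ≥0),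
      IsUnitaryGroup T₁.D U₁ ∧ IsUnitaryGroup T₂.D U₂ ∧ IsIsoIso ε ς₁ ς₂ ∧
        magnitude τ U₁ U₂ ε ς₁ ς₂ < ENNReal.ofReal ε)}

/-! ### Indexing the eigenvalues -/

/-- `(lam j)_{j ∈ Y}` lists the spectrum of `D` in increasing order and without repetition, along
an interval `Y` of `ℤ` containing `0`, with index `0` at the smallest nonnegative element. Values
of `lam` off `Y` are irrelevant. -/
structure IsSpectrumIndexing {H : Type v} [NormedAddCommGroup H] [InnerProductSpace ℂ H]
    (D : H →ₗ.[ℂ] H) (Y : Set ℤ) (lam : ℤ → ℝ) : Prop where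
  ordConnected : Y.OrdConnected
  zero_mem : (0 : ℤ) ∈ Y
  strictMonoOn : StrictMonoOn lam Y
  image_eq : (fun j => (lam j : ℂ)) '' Y = opSpectrum D
  isLeast : IsLeast {x : ℝ | (x : ℂ) ∈ opSpectrum D ∧ 0 ≤ x} (lam 0)

end SpectralPropinquity

end

namespace SpectralPropinquity

/-! ### Resolvents of an unbounded operator. -/

section Resolvent

variable {E : Type v} [NormedAddCommGroup E] [InnerProductSpace ℂ E]

/-! The analytic core is that a small reach forces spectra to be close on bounded sets. Let `ξ` be
an eigenvector of `D₁` for `μ`, of graph norm `1`, and let `η` be a partner of `ξ` under the reach.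
Testing against a lift `ω` of `ξ / 2`, the function `t ↦ ⟨U₂(-t) η, Π₂ ω⟩` stays within `2ε` of `c
e^{itμ}` on `[0, 1/ε]`, where `c = 1 / (2(1+|μ|)²)`. If `μ` is at distance at least `r` from
`σ(D₂)`, then `η = (D₂ - μ) ζ` with `‖ζ‖ ≤ 1/r`. So, up to a factor `i`, `e^{-itμ} ⟨U₂(-t) η, Π₂ ω⟩`
is the derivative of a function bounded by `1/r`, and its mean over `[0, 1/ε]` is at most `2ε/r`.
Hence `c ≤ 2ε + 2ε/r`, which fails for small `ε` (`IsUnitaryGroup.norm_mul_le`,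
`one_div_le_of_halfReach_lt`).

The rest is order combinatorics on locally convergent discrete sets. The gaps `δ_j` prevent
consecutive eigenvalues from merging in the limit, so convergence at one index propagates to its
neighbours (`tendsto_succ`, `tendsto_pred`, `tendsto_sub`). It remains to locate the base index. If
`0 ∉ σ(D_∞)`, signs are preserved near `λ_∞^0` and index `0` works. If `0 ∈ σ(D_∞)`, the
approximating eigenvalue may lie on either side of `0`, which accounts for the shift `s_n`. -/

/-- On the domain, `D - (z + δ) = (1 - δR)(D - z)`, so the new resolvent is `R (1 - δR)⁻¹`. -/
theorem IsResolventAt.exists_add {D : E →ₗ.[ℂ] E} {z δ : ℂ} {R : E →L[ℂ] E}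
    (hR : IsResolventAt D z R) (h : IsUnit (1 - δ • R)) :
    ∃ R' : E →L[ℂ] E, IsResolventAt D (z + δ) R' := by
  obtain ⟨⟨V, W, hVW, hWV⟩, rfl : V = 1 - δ • R⟩ := h
  have hVW' : ∀ x, W x - δ • R (W x) = x := fun x => by
    simpa using DFunLike.congr_fun hVW x
  have hWV' : ∀ x, W (x - δ • R x) = x := fun x => by
    simpa using DFunLike.congr_fun hWV x
  refine ⟨R * W, fun x => ?_, fun x => ?_⟩
  · obtain ⟨h, hx⟩ := hR.1 (W x)
    refine ⟨h, ?_⟩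
    have := hVW' x
    change D ⟨R (W x), h⟩ - (z + δ) • R (W x) = x
    rw [add_smul, ← sub_sub, hx, this]
  · have hx := hR.2 x
    have : D x - (z + δ) • (x : E) =
        (D x - z • (x : E)) - δ • R (D x - z • (x : E)) := by
      rw [hx, add_smul, sub_sub]
    change R (W _) = x
    rw [this, hWV', hx]

theorem IsResolventAt.apply_sub_smul {D : E →ₗ.[ℂ] E} {z δ : ℂ} {R R' : E →L[ℂ] E}
    (hR : IsResolventAt D z R) (hR' : IsResolventAt D (z + δ) R') (x : E) :
    R' (x - δ • R x) = R x := by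
  obtain ⟨h, hx⟩ := hR.1 x
  have := hR'.2 ⟨R x, h⟩
  rwa [add_smul, ← sub_sub, hx] at this

/-- The resolvent identity, read in both directions, shows that `1 + δR'` is the inverse. -/
theorem IsResolventAt.isUnit_one_sub {D : E →ₗ.[ℂ] E} {z δ : ℂ} {R R' : E →L[ℂ] E}
    (hR : IsResolventAt D z R) (hR' : IsResolventAt D (z + δ) R') : IsUnit (1 - δ • R) := by
  have h1 := hR.apply_sub_smul hR'
  have h2 := hR'.apply_sub_smul (δ := -δ) (R' := R) (by simpa using hR)
  refine ⟨⟨1 - δ • R, 1 + δ • R', ?_, ?_⟩, rfl⟩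
  · ext x
    have := h2 x
    simp only [neg_smul, sub_neg_eq_add] at this
    simp [this]
  · ext x
    have := h1 x
    change (x - δ • R x) + δ • R' (x - δ • R x) = x
    rw [this]; simp

theorem isOpen_compl_opSpectrum [CompleteSpace E] (D : E →ₗ.[ℂ] E) : IsOpen (opSpectrum D)ᶜ := by
  rw [isOpen_iff_mem_nhds]
  intro z hz
  obtain ⟨R, hR⟩ := not_not.1 hz
  have hcont : Continuous fun y : ℂ => (1 : E →L[ℂ] E) - (y - z) • R := by fun_prop
  have : {y : ℂ | IsUnit ((1 : E →L[ℂ] E) - (y - z) • R)} ∈ 𝓝 z :=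
    (Units.isOpen.preimage hcont).mem_nhds (by simp)
  filter_upwards [this] with y hy
  have := hR.exists_add hy
  rw [add_sub_cancel] at this
  exact not_not.2 this

theorem IsResolventAt.isSelfAdjoint [CompleteSpace E] {D : E →ₗ.[ℂ] E}
    (hD : D.IsFormalAdjoint D) {μ : ℝ} {R : E →L[ℂ] E} (hR : IsResolventAt D μ R) :
    IsSelfAdjoint R := by
  rw [ContinuousLinearMap.isSelfAdjoint_iff_isSymmetric]
  intro x y
  obtain ⟨hx, hx'⟩ := hR.1 x
  obtain ⟨hy, hy'⟩ := hR.1 y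
  have := hD ⟨R x, hx⟩ ⟨R y, hy⟩
  change inner ℂ (R x) y = inner ℂ x (R y)
  rw [← hx', ← hy', inner_sub_left, inner_sub_right, hx', hy', inner_smul_left,
    inner_smul_right, Complex.conj_ofReal, this]

/-- The resolvent of a self-adjoint operator is bounded by the inverse of the distance to the
spectrum. -/
theorem exists_isResolventAt_norm_le [CompleteSpace E] {D : E →ₗ.[ℂ] E}
    (hD : D.IsFormalAdjoint D) {μ r : ℝ} (hr : 0 < r)
    (h : ∀ ν : ℝ, |ν - μ| < r → (ν : ℂ) ∉ opSpectrum D) :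
    ∃ R : E →L[ℂ] E, IsResolventAt D μ R ∧ ‖R‖ ≤ 1 / r := by
  obtain ⟨R, hR⟩ := not_not.1 (h μ (by simpa using hr))
  refine ⟨R, hR, ?_⟩
  have hsa := hR.isSelfAdjoint hD
  have hk : ∀ k ∈ spectrum ℂ R, ‖k‖ ≤ 1 / r := by
    intro k hk
    by_contra! hlt
    have hkpos : 0 < ‖k‖ := lt_trans (by positivity) hlt
    have hk0 : k ≠ 0 := norm_pos_iff.1 hkpos
    -- Self-adjointness makes `k` real, so `μ + k⁻¹` is a real point within `r` of `μ`, where a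
    -- resolvent exists; this makes `1 - k⁻¹R` invertible and contradicts `k ∈ spectrum ℂ R`.
    have hre : (k.re : ℂ) = k := (hsa.mem_spectrum_eq_re hk).symm
    have hn : |k.re| = ‖k‖ := by rw [← hre, Complex.norm_real]; simp
    obtain ⟨R', hR'⟩ := not_not.1 (h (μ + k.re⁻¹) (by
      rw [add_sub_cancel_left, abs_inv, hn]
      exact inv_lt_of_inv_lt₀ hr (by simpa using hlt)))
    have hu := hR.isUnit_one_sub (δ := k⁻¹) (R' := R') (by
      rw [← hre]; push_cast at hR'; exact hR')
    refine hk ?_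
    rw [spectrum.mem_resolventSet_iff, Algebra.algebraMap_eq_smul_one]
    have := hu.smul (Units.mk0 k hk0)
    simpa [Units.smul_def, smul_sub, smul_smul, hk0] using this
  -- For self-adjoint `R` the norm equals the spectral radius, so the bound on the spectrum bounds
  -- `‖R‖`.
  have := hsa.spectralRadius_eq_nnnorm
  have hle : spectralRadius ℂ R ≤ ENNReal.ofReal (1 / r) := by
    refine iSup₂_le fun k hks => ?_
    rw [← enorm_eq_nnnorm, ← ofReal_norm]
    exact ENNReal.ofReal_le_ofReal (hk k hks)
  rw [this, ← enorm_eq_nnnorm, ← ofReal_norm] at hle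
  exact (ENNReal.ofReal_le_ofReal_iff (by positivity)).1 hle

/-- The point `(μ - z)⁻¹` is a nonzero spectral value of the compact operator `R`, hence an
eigenvalue. If `x` is an eigenvector, `R x` is a multiple of it that visibly lies in the domain of
`D`. -/
theorem exists_eigenvector [CompleteSpace E] {D : E →ₗ.[ℂ] E} {z μ : ℂ} {R : E →L[ℂ] E}
    (hR : IsResolventAt D z R) (hc : IsCompactOperator R) (hμz : μ ≠ z)
    (hμ : μ ∈ opSpectrum D) : ∃ ξ : D.domain, (ξ : E) ≠ 0 ∧ D ξ = μ • (ξ : E) := by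
  have hδ : μ - z ≠ 0 := sub_ne_zero.2 hμz
  have hspec : (μ - z)⁻¹ ∈ spectrum ℂ R := by
    intro hu
    refine hμ ?_
    rw [← add_sub_cancel z μ]
    refine hR.exists_add ?_
    have := hu.smul (Units.mk0 _ hδ)
    simpa [Algebra.algebraMap_eq_smul_one, Units.smul_def, smul_sub, smul_smul, hδ] using this
  obtain ⟨x, hx⟩ := ((hc.hasEigenvalue_iff_mem_spectrum (inv_ne_zero hδ)).2 hspec).exists_hasEigenvector
  have hx1 : R x = (μ - z)⁻¹ • x := hx.apply_eq_smul
  obtain ⟨hd, hx2⟩ := hR.1 x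
  refine ⟨⟨R x, hd⟩, ?_, ?_⟩
  · change R x ≠ 0
    rw [hx1]
    exact smul_ne_zero (inv_ne_zero hδ) hx.2
  · rw [sub_eq_iff_eq_add] at hx2
    rw [hx2]
    change x + z • R x = μ • R x
    have : x = (μ - z) • R x := by rw [hx1, smul_smul, mul_inv_cancel₀ hδ, one_smul]
    nth_rewrite 1 [this]
    rw [← add_smul, sub_add_cancel]

end Resolvent

/-! ### Orbits of the unitary group and averaging in time. -/

section UnitaryGroup

variable {E : Type v} [NormedAddCommGroup E] [InnerProductSpace ℂ E] {D : E →ₗ.[ℂ] E}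
  {U : ℝ → E ≃ₗᵢ[ℂ] E}

theorem IsUnitaryGroup.hasDerivAt (hU : IsUnitaryGroup D U) (ξ : D.domain) (t : ℝ) :
    HasDerivAt (fun s : ℝ => U s (ξ : E)) (U t (Complex.I • D ξ)) t := by
  have h := (hU.generator ξ)
  rw [← sub_self t] at h
  have h2 := h.comp_sub_const t t
  have h3 := ((U t).toContinuousLinearEquiv : E →L[ℂ] E).restrictScalars ℝ |>.hasFDerivAt.comp_hasDerivAt t h2
  refine h3.congr_of_eventuallyEq (Eventually.of_forall fun s => ?_)
  change U s (ξ : E) = U t (U (s - t) ξ)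
  rw [← hU.add, add_sub_cancel]

theorem IsUnitaryGroup.norm_sub_le (hU : IsUnitaryGroup D U) (ξ : D.domain) (s t : ℝ) :
    ‖U s (ξ : E) - U t (ξ : E)‖ ≤ ‖D ξ‖ * |s - t| := by
  have := Convex.norm_image_sub_le_of_norm_hasDerivWithin_le (s := Set.univ) (x := t) (y := s)
    (f := fun s : ℝ => U s (ξ : E)) (C := ‖D ξ‖)
    (fun x _ => (hU.hasDerivAt ξ x).hasDerivWithinAt)
    (fun x _ => by rw [LinearIsometryEquiv.norm_map, norm_smul]; simp) convex_univ trivial trivial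
  simpa using this

/-- The curve `t ↦ e^{-itμ} U t ξ` has zero derivative, hence is constant. -/
theorem IsUnitaryGroup.apply_eigenvector (hU : IsUnitaryGroup D U) {ξ : D.domain} {μ : ℝ}
    (hξ : D ξ = (μ : ℂ) • (ξ : E)) (t : ℝ) :
    U t (ξ : E) = Complex.exp (t * μ * Complex.I) • (ξ : E) := by
  have he : ∀ s : ℝ, HasDerivAt (fun s : ℝ => Complex.exp (-(s * μ * Complex.I)))
      (Complex.exp (-(s * μ * Complex.I)) * -(μ * Complex.I)) s := fun s => by
    have h1 : HasDerivAt (fun s : ℝ => (s : ℂ)) 1 s := Complex.ofRealCLM.hasDerivAt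
    simpa [mul_assoc] using ((h1.mul_const ((μ : ℂ) * Complex.I)).neg).cexp
  have hd : ∀ s : ℝ, HasDerivAt (fun s : ℝ => Complex.exp (-(s * μ * Complex.I)) • U s (ξ : E))
      0 s := fun s => by
    have := (he s).smul (hU.hasDerivAt ξ s)
    refine this.congr_deriv ?_
    rw [hξ]
    simp only [map_smul, smul_smul, ← add_smul]
    rw [show Complex.exp (-(s * μ * Complex.I)) * (Complex.I * μ) +
      Complex.exp (-(s * μ * Complex.I)) * -(μ * Complex.I) = 0 by ring, zero_smul]
  have hconst := is_const_of_deriv_eq_zero (fun s => (hd s).differentiableAt)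
    (fun s => (hd s).deriv) t 0
  simp only [Complex.ofReal_zero, zero_mul, neg_zero, Complex.exp_zero, one_smul, hU.zero] at hconst
  conv_rhs => rw [← hconst]
  rw [smul_smul, ← Complex.exp_add, add_neg_cancel, Complex.exp_zero, one_smul]

/-- If `η ↦ ⟨U (-t) η, x⟩` stays `C`-close to `c e^{i t μ}` on `[0, T]` and the resolvent of `D` at
`μ` sends `η` to `ζ`, then `c` is small. -/
theorem IsUnitaryGroup.norm_mul_le (hU : IsUnitaryGroup D U) {ζ : D.domain} {η x : E} {μ : ℝ}
    (hζ : D ζ - (μ : ℂ) • (ζ : E) = η) {c : ℂ} {C T : ℝ} (hT : 0 ≤ T)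
    (h : ∀ t : ℝ, 0 ≤ t → t ≤ T →
      ‖inner ℂ (U (-t) η) x - Complex.exp (t * μ * Complex.I) * c‖ ≤ C) :
    ‖c‖ * T ≤ C * T + 2 * (‖(ζ : E)‖ * ‖x‖) := by
  have hDζ : D ζ = η + (μ : ℂ) • (ζ : E) := by rw [← hζ, sub_add_cancel]
  have he : ∀ s : ℝ, HasDerivAt (fun s : ℝ => Complex.exp (-(s * μ * Complex.I)))
      (Complex.exp (-(s * μ * Complex.I)) * -(μ * Complex.I)) s := fun s => by
    have h1 : HasDerivAt (fun s : ℝ => (s : ℂ)) 1 s := Complex.ofRealCLM.hasDerivAt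
    simpa [mul_assoc] using ((h1.mul_const ((μ : ℂ) * Complex.I)).neg).cexp
  have hi : ∀ s : ℝ, HasDerivAt (fun s : ℝ => inner ℂ (U (-s) (ζ : E)) x)
      (Complex.I * inner ℂ (U (-s) η) x + μ * Complex.I * inner ℂ (U (-s) (ζ : E)) x) s := by
    intro s
    have h1 := (hU.hasDerivAt ζ (-s)).scomp s (hasDerivAt_neg s)
    have h2 := h1.inner ℂ (hasDerivAt_const s x)
    refine h2.congr_deriv ?_
    rw [hDζ]
    simp only [inner_zero_right, zero_add, map_smul, map_add, inner_smul_left, inner_add_left,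
      inner_neg_left, neg_smul, one_smul, smul_add, Complex.conj_I, Complex.conj_ofReal]
    ring
  -- Since `η = (D - μ) ζ`, the `μ` terms cancel. Subtracting the drift `s i c` leaves a function
  -- whose derivative is, up to a unimodular factor, the quantity bounded by `C`.
  have hd : ∀ s : ℝ, HasDerivAt (fun s : ℝ => Complex.exp (-(s * μ * Complex.I)) *
      inner ℂ (U (-s) (ζ : E)) x - s * (Complex.I * c))
      (Complex.I * (Complex.exp (-(s * μ * Complex.I)) *
        (inner ℂ (U (-s) η) x - Complex.exp (s * μ * Complex.I) * c))) s := by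
    intro s
    have h1 : HasDerivAt (fun s : ℝ => (s : ℂ)) 1 s := Complex.ofRealCLM.hasDerivAt
    refine (((he s).mul (hi s)).sub (h1.mul_const (Complex.I * c))).congr_deriv ?_
    have : Complex.exp (-(s * μ * Complex.I)) * Complex.exp (s * μ * Complex.I) = 1 := by
      rw [← Complex.exp_add, neg_add_cancel, Complex.exp_zero]
    linear_combination (Complex.I * c) * this
  have hexp : ∀ s : ℝ, ‖Complex.exp (-(s * μ * Complex.I))‖ = 1 := fun s => by
    rw [← neg_mul]; exact_mod_cast Complex.norm_exp_ofReal_mul_I (-(s * μ))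
  have hmv := Convex.norm_image_sub_le_of_norm_hasDerivWithin_le (s := Set.Icc 0 T) (x := 0)
    (y := T) (C := C) (fun s _ => (hd s).hasDerivWithinAt)
    (fun s hs => by rw [norm_mul, norm_mul, hexp, Complex.norm_I, one_mul, one_mul]
                    exact h s hs.1 hs.2)
    (convex_Icc 0 T) ⟨le_rfl, hT⟩ ⟨hT, le_rfl⟩
  have hb : ∀ s : ℝ, ‖Complex.exp (-(s * μ * Complex.I)) * inner ℂ (U (-s) (ζ : E)) x‖ ≤
      ‖(ζ : E)‖ * ‖x‖ := fun s => by
    rw [norm_mul, hexp, one_mul]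
    simpa using norm_inner_le_norm (𝕜 := ℂ) (U (-s) (ζ : E)) x
  have h0 := hb 0
  have h1 := hb T
  simp only [sub_zero, Real.norm_eq_abs, abs_of_nonneg hT] at hmv
  generalize Complex.exp (-((T : ℝ) * μ * Complex.I)) * inner ℂ (U (-T) (ζ : E)) x = a at *
  generalize Complex.exp (-((0 : ℝ) * μ * Complex.I)) * inner ℂ (U (-0) (ζ : E)) x = b at *
  have hc : ‖c‖ * T = ‖(T : ℂ) * (Complex.I * c)‖ := by
    simp [abs_of_nonneg hT, mul_comm]
  rw [hc, show (T : ℂ) * (Complex.I * c) =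
    a - b - (a - T * (Complex.I * c) - (b - (0 : ℝ) * (Complex.I * c))) by push_cast; ring]
  calc _ ≤ ‖a - b‖ + _ := _root_.norm_sub_le _ _
    _ ≤ (‖a‖ + ‖b‖) + C * T := add_le_add (_root_.norm_sub_le _ _) hmv
    _ ≤ _ := by linarith

end UnitaryGroup

/-! ### From a small reach to nearby eigenvalues. -/

section Correspondence

/-- The module map intertwines the inner products, and *-morphisms of C*-algebras are contractive.
-/
theorem ModularQuantumIsometry.norm_modMap_le {P : CorrespondenceData.{w, w, w}}
    {Q : CorrespondenceData.{v, u, 0}} (Φ : ModularQuantumIsometry P Q) (ω : P.M) :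
    ‖Φ.modMap ω‖ ≤ ‖ω‖ := by
  rw [P.norm_eq, Q.norm_eq, ← Φ.map_ip]
  exact Real.sqrt_le_sqrt (NonUnitalStarAlgHom.norm_apply_le Φ.rightMap _)

theorem graphNorm_coe {E : Type v} [NormedAddCommGroup E] [InnerProductSpace ℂ E]
    (D : E →ₗ.[ℂ] E) (ξ : D.domain) : graphNorm D (ξ : E) = ENNReal.ofReal (‖(ξ : E)‖ + ‖D ξ‖) := by
  rw [graphNorm, dif_pos ξ.2, ENNReal.ofReal_add (norm_nonneg _) (norm_nonneg _), ofReal_norm,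
    ofReal_norm]

theorem exists_of_graphNorm_le_one {E : Type v} [NormedAddCommGroup E] [InnerProductSpace ℂ E]
    {D : E →ₗ.[ℂ] E} {ξ : E} (h : graphNorm D ξ ≤ 1) :
    ∃ η : D.domain, (η : E) = ξ ∧ ‖ξ‖ + ‖D η‖ ≤ 1 := by
  by_cases hξ : ξ ∈ D.domain
  · refine ⟨⟨ξ, hξ⟩, rfl, ?_⟩
    have := graphNorm_coe D ⟨ξ, hξ⟩
    change graphNorm D ξ = _ at this
    rw [this] at h
    exact ENNReal.ofReal_le_one.1 h
  · rw [graphNorm, dif_neg hξ] at h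
    simp at h

theorem SpectralTriple.isFormalAdjoint (T : SpectralTriple.{u, v}) : T.D.IsFormalAdjoint T.D := by
  have h := LinearPMap.adjoint_isFormalAdjoint T.dense_domain
  rwa [LinearPMap.isSelfAdjoint_def.1 T.isSelfAdjoint] at h

/-- The normalisation gives graph norm `‖ξ‖ + |μ| ‖ξ‖ = 1`. -/
theorem SpectralTriple.exists_eigenvector (T : SpectralTriple.{u, v}) {μ : ℝ}
    (hμ : (μ : ℂ) ∈ opSpectrum T.D) :
    ∃ ξ : T.D.domain, T.D ξ = (μ : ℂ) • (ξ : T.H) ∧ ‖(ξ : T.H)‖ = 1 / (1 + |μ|) := by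
  obtain ⟨R, hR, hc⟩ := T.compact_resolvent
  obtain ⟨ξ, h0, hξ⟩ := SpectralPropinquity.exists_eigenvector hR hc
    (fun h => by simpa using congrArg Complex.im h) hμ
  have hpos : 0 < 1 + |μ| := by positivity
  refine ⟨((1 / ((1 + |μ|) * ‖(ξ : T.H)‖) : ℝ) : ℂ) • ξ, ?_, ?_⟩
  · rw [LinearPMap.map_smul, hξ, smul_comm]; rfl
  · have : ‖(ξ : T.H)‖ ≠ 0 := norm_ne_zero_iff.2 h0
    rw [Submodule.coe_smul, norm_smul, Complex.norm_real, Real.norm_of_nonneg (by positivity)]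
    field_simp

theorem IsIsoIso.abs_sub_le {ε : ℝ} {ς₁ ς₂ : ℝ≥0 → ℝ≥0} (h : IsIsoIso ε ς₁ ς₂) (hε : 0 < ε)
    {t : ℝ≥0} (ht : (t : ℝ) ≤ 1 / ε) : |(ς₁ t : ℝ) - t| ≤ ε ∧ |(ς₂ t : ℝ) - t| ≤ ε := by
  obtain ⟨h1, h2, h⟩ := h
  have h0 : ((0 : ℝ≥0) : ℝ) ≤ 1 / ε := by simpa using hε.le
  -- At `x = y = 0` and `z = t` the two inequalities reduce to `|t - ς₂ t| < ε` and `|t - ς₁ t| <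
  -- ε`.
  have := h 0 0 t h0 h0 ht
  simp only [h1, h2, NNReal.coe_zero, add_zero, zero_sub, abs_neg, NNReal.abs_eq] at this
  exact ⟨by rw [abs_sub_comm]; exact this.2.le, by rw [abs_sub_comm]; exact this.1.le⟩

theorem exists_of_halfReach_lt {F K G H : ℝ} {T₁ T₂ : SpectralTriple.{u, v}}
    {τ : Tunnel.{u, v, w} F K G H T₁.mcc T₂.mcc}
    {U₁ : ℝ → T₁.H ≃ₗᵢ[ℂ] T₁.H} {U₂ : ℝ → T₂.H ≃ₗᵢ[ℂ] T₂.H} {ε : ℝ} {ς : ℝ≥0 → ℝ≥0}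
    (h : halfReach τ U₁ U₂ ε ς < ENNReal.ofReal ε) {ξ : T₁.H} (hξ : graphNorm T₁.D ξ ≤ 1) :
    ∃ η : T₂.H, graphNorm T₂.D η ≤ 1 ∧ ∀ t : ℝ≥0, (t : ℝ) ≤ 1 / ε → ∀ ω : τ.P.M,
      τ.P.DN ω ≤ 1 → ‖inner ℂ (U₁ (-(t : ℝ)) ξ) (τ.fst.modMap ω : T₁.H) -
          inner ℂ (U₂ (-(ς t : ℝ)) η) (τ.snd.modMap ω : T₂.H)‖ ≤ ε := by
  have hε : 0 < ε := ENNReal.ofReal_pos.1 (bot_le.trans_lt h)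
  have h1 := (le_iSup₂ (f := fun (x : T₁.H) (_ : x ∈ {ξ | graphNorm T₁.D ξ ≤ 1}) => _) ξ hξ).trans_lt h
  obtain ⟨η, h2⟩ := iInf_lt_iff.1 h1
  obtain ⟨hη, h3⟩ := iInf_lt_iff.1 h2
  refine ⟨η, hη, fun t ht ω hω => ?_⟩
  have h4 := (le_iSup₂ (f := fun (t : ℝ≥0) (_ : (t : ℝ) ≤ 1 / ε) => _) t ht).trans h3.le
  have h5 := (le_iSup₂ (f := fun (ω : τ.P.M) (_ : τ.P.DN ω ≤ 1) => _) ω hω).trans h4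
  rw [← ofReal_norm] at h5
  exact (ENNReal.ofReal_le_ofReal_iff hε.le).1 h5

/-- The quotient norm of `ξ` is at most `1`, so some lift has D-norm below `2`. Halving it reaches
the unit ball without needing the infimum to be attained. -/
theorem Tunnel.exists_modMap_fst_eq {F K G H : ℝ} {T₁ T₂ : SpectralTriple.{u, v}}
    (τ : Tunnel.{u, v, w} F K G H T₁.mcc T₂.mcc) {ξ : T₁.H} (hξ : graphNorm T₁.D ξ ≤ 1) :
    ∃ ω : τ.P.M, τ.P.DN ω ≤ 1 ∧ (τ.fst.modMap ω : T₁.H) = (1 / 2 : ℂ) • ξ := by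
  have h := τ.fst.quotient_DN ξ (ne_top_of_le_ne_top ENNReal.one_ne_top hξ)
  have h1 : (⨅ (η : τ.P.M) (_ : τ.fst.modMap η = ξ), τ.P.DN η) < 2 := by
    rw [← h]; exact lt_of_le_of_lt hξ (by norm_num)
  obtain ⟨ω, h2⟩ := iInf_lt_iff.1 h1
  obtain ⟨rfl, h3⟩ := iInf_lt_iff.1 h2
  refine ⟨(1 / 2 : ℂ) • ω, ?_, map_smul _ _ _⟩
  rw [τ.isMetrical.smul]
  have : ‖(1 / 2 : ℂ)‖ₑ = 2⁻¹ := by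
    rw [← ofReal_norm]; simp
  rw [this, ← ENNReal.inv_mul_cancel (a := 2) (by norm_num) (by norm_num)]
  gcongr

/-- The distance from an eigenvalue of one triple to the spectrum of another is controlled by the
half reach of a tunnel between them. -/
theorem one_div_le_of_halfReach_lt {F K G H : ℝ} {T₁ T₂ : SpectralTriple.{u, v}}
    {τ : Tunnel.{u, v, w} F K G H T₁.mcc T₂.mcc}
    {U₁ : ℝ → T₁.H ≃ₗᵢ[ℂ] T₁.H} {U₂ : ℝ → T₂.H ≃ₗᵢ[ℂ] T₂.H} {ε : ℝ} {ς : ℝ≥0 → ℝ≥0}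
    (hU₁ : IsUnitaryGroup T₁.D U₁) (hU₂ : IsUnitaryGroup T₂.D U₂)
    (h : halfReach τ U₁ U₂ ε ς < ENNReal.ofReal ε)
    (hς : ∀ t : ℝ≥0, (t : ℝ) ≤ 1 / ε → |(ς t : ℝ) - t| ≤ ε)
    {μ r : ℝ} (hμ : (μ : ℂ) ∈ opSpectrum T₁.D) (hr : 0 < r)
    (hfar : ∀ ν : ℝ, |ν - μ| < r → (ν : ℂ) ∉ opSpectrum T₂.D) :
    1 / (2 * (1 + |μ|) ^ 2) ≤ ε * (2 + 2 / r) := by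
  have hε : 0 < ε := ENNReal.ofReal_pos.1 (bot_le.trans_lt h)
  obtain ⟨ξ, hξ, hnorm⟩ := T₁.exists_eigenvector hμ
  have hpos : 0 < 1 + |μ| := by positivity
  have hgξ : graphNorm T₁.D (ξ : T₁.H) ≤ 1 := by
    rw [graphNorm_coe, hξ, norm_smul, hnorm, Complex.norm_real, Real.norm_eq_abs,
      ENNReal.ofReal_le_one]
    apply le_of_eq
    field_simp
  obtain ⟨η, hgη, hη⟩ := exists_of_halfReach_lt h hgξ
  obtain ⟨η', rfl, hη'⟩ := exists_of_graphNorm_le_one hgη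
  obtain ⟨ω, hω, hωξ⟩ := τ.exists_modMap_fst_eq hgξ
  obtain ⟨R, hR, hRr⟩ := exists_isResolventAt_norm_le T₂.isFormalAdjoint hr hfar
  obtain ⟨hζ, hζη⟩ := hR.1 η'
  set x : T₂.H := τ.snd.modMap ω with hx
  have hx1 : ‖x‖ ≤ 1 := by
    have h1 : ‖ω‖ₑ ≤ 1 := (τ.isMetrical.norm_le ω).trans hω
    rw [← ofReal_norm, ENNReal.ofReal_le_one] at h1
    exact (τ.snd.norm_modMap_le ω).trans h1
  have hη1 : ‖(η' : T₂.H)‖ ≤ 1 := by linarith [norm_nonneg (T₂.D η')]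
  have hDη1 : ‖T₂.D η'‖ ≤ 1 := by linarith [norm_nonneg (η' : T₂.H)]
  set c : ℂ := inner ℂ (ξ : T₁.H) ((1 / 2 : ℂ) • (ξ : T₁.H)) with hc
  have hcn : ‖c‖ = 1 / (2 * (1 + |μ|) ^ 2) := by
    rw [hc, inner_smul_right, inner_self_eq_norm_sq_to_K, hnorm]
    rw [norm_mul, norm_pow, RCLike.norm_ofReal, abs_of_pos (by positivity)]
    norm_num
    ring
  have hRη : ‖R η'‖ ≤ 1 / r := by
    calc _ ≤ ‖R‖ * ‖(η' : T₂.H)‖ := R.le_opNorm _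
      _ ≤ 1 / r * 1 := by gcongr
      _ = _ := mul_one _
  -- The error `2 * ε` is one `ε` from the reach and one from replacing `ς t` by `t`, since orbits
  -- of `η'` are `1`-Lipschitz. The length `1 / ε` is the range of times on which both estimates
  -- hold.
  have key := hU₂.norm_mul_le (ζ := ⟨R η', hζ⟩) (x := x) (c := c) (C := 2 * ε) (T := 1 / ε) hζη
    (by positivity) (fun t ht0 htT => by
      lift t to ℝ≥0 using ht0
      have h1 := hη t htT ω hω
      have h2 : inner ℂ (U₁ (-(t : ℝ)) (ξ : T₁.H)) (τ.fst.modMap ω : T₁.H) =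
          Complex.exp ((t : ℝ) * μ * Complex.I) * c := by
        rw [hU₁.apply_eigenvector hξ, hωξ, inner_smul_left, ← Complex.exp_conj, ← hc]
        simp only [map_mul, Complex.conj_ofReal, Complex.conj_I]
        push_cast
        congr 2
        ring
      rw [h2, ← hx] at h1
      have h3 : ‖inner ℂ (U₂ (-(ς t : ℝ)) (η' : T₂.H)) x - inner ℂ (U₂ (-(t : ℝ)) (η' : T₂.H)) x‖
          ≤ ε := by
        rw [← inner_sub_left]
        calc _ ≤ _ := norm_inner_le_norm _ _
          _ ≤ (1 * ε) * 1 := by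
            gcongr
            refine (hU₂.norm_sub_le η' _ _).trans ?_
            gcongr
            rw [neg_sub_neg, abs_sub_comm]
            exact hς t htT
          _ = ε := by ring
      calc _ = ‖(Complex.exp ((t : ℝ) * μ * Complex.I) * c -
              inner ℂ (U₂ (-(ς t : ℝ)) (η' : T₂.H)) x) +
            (inner ℂ (U₂ (-(ς t : ℝ)) (η' : T₂.H)) x - inner ℂ (U₂ (-(t : ℝ)) (η' : T₂.H)) x)‖ := by
            rw [← norm_neg]; congr 1; ring
        _ ≤ ε + ε := norm_add_le_of_le h1 h3
        _ = 2 * ε := by ring)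
  have hprod : ‖R η'‖ * ‖x‖ ≤ 1 / r := by
    calc _ ≤ 1 / r * 1 := by gcongr
      _ = _ := mul_one _
  rw [← hcn]
  have h5 : ‖c‖ * (1 / ε) ≤ 2 * ε * (1 / ε) + 2 * (1 / r) := by
    refine key.trans ?_
    gcongr
  calc ‖c‖ = ε * (‖c‖ * (1 / ε)) := by field_simp
    _ ≤ ε * (2 * ε * (1 / ε) + 2 * (1 / r)) := by gcongr
    _ = _ := by field_simp

end Correspondence

/-! ### Local closeness of spectra. -/

section Convergence

/-- Triples that are close for the spectral propinquity have close spectra on bounded sets. -/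
theorem exists_spectrum_close (F K G H : ℝ) {B r : ℝ} (hB : 0 ≤ B) (hr : 0 < r) :
    ∃ ε₀ > 0, ∀ T₁ T₂ : SpectralTriple.{u, v},
      spectralPropinquity.{u, v, w} F K G H T₁ T₂ < ε₀ →
      (∀ μ : ℝ, |μ| ≤ B → (μ : ℂ) ∈ opSpectrum T₁.D →
        ∃ ν : ℝ, |ν - μ| < r ∧ (ν : ℂ) ∈ opSpectrum T₂.D) ∧
      (∀ μ : ℝ, |μ| ≤ B → (μ : ℂ) ∈ opSpectrum T₂.D →
        ∃ ν : ℝ, |ν - μ| < r ∧ (ν : ℂ) ∈ opSpectrum T₁.D) := by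
  -- The bound `√2 / 2` rules out the default member of the set defining the propinquity; the other
  -- one makes `ε * (2 + 2 / r)` smaller than `c` for every `|μ| ≤ B`.
  refine ⟨min (√2 / 2) (1 / (2 * (1 + B) ^ 2) / (2 + 2 / r)), by positivity,
    fun T₁ T₂ h => ?_⟩
  rw [spectralPropinquity] at h
  obtain ⟨ε, hmem, hlt⟩ := exists_lt_of_csInf_lt ⟨√2 / 2, Or.inl rfl⟩ h
  rcases hmem with rfl | ⟨hε, U₁, U₂, τ, ς₁, ς₂, hU₁, hU₂, hiso, hmag⟩
  · exact absurd (hlt.trans_le (min_le_left _ _)) (lt_irrefl _)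
  have hlt' : ε * (2 + 2 / r) < 1 / (2 * (1 + B) ^ 2) :=
    (lt_div_iff₀ (by positivity)).1 (hlt.trans_le (min_le_right _ _))
  have hmono : ∀ μ : ℝ, |μ| ≤ B → 1 / (2 * (1 + B) ^ 2) ≤ 1 / (2 * (1 + |μ|) ^ 2) :=
    fun μ hμ => by gcongr
  have h₁ := ((le_max_left _ _).trans (le_max_right _ _)).trans_lt hmag
  have h₂ := ((le_max_right _ _).trans (le_max_right _ _)).trans_lt hmag
  constructor
  · intro μ hμB hμ
    by_contra! hcon
    exact absurd (one_div_le_of_halfReach_lt hU₁ hU₂ h₁ (fun t ht => (hiso.abs_sub_le hε ht).1) hμ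
      hr hcon) (not_le.2 (hlt'.trans_le (hmono μ hμB)))
  · intro μ hμB hμ
    by_contra! hcon
    exact absurd (one_div_le_of_halfReach_lt hU₂ hU₁ h₂ (fun t ht => (hiso.abs_sub_le hε ht).2) hμ
      hr hcon) (not_le.2 (hlt'.trans_le (hmono μ hμB)))

end Convergence

/-! ### Propagating convergence along the index. -/

section Indexing

variable {Y : ℕ → Set ℤ} {lam : ℕ → ℤ → ℝ} {Yinf : Set ℤ} {laminf : ℤ → ℝ}

/-- The sets `{lam n k : k ∈ Y n}` converge to `{laminf j : j ∈ Yinf}` on bounded sets. -/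
structure LocallyConverges (Y : ℕ → Set ℤ) (lam : ℕ → ℤ → ℝ) (Yinf : Set ℤ) (laminf : ℤ → ℝ) :
    Prop where
  exists_near : ∀ j ∈ Yinf, ∀ r > 0, ∀ᶠ n in atTop, ∃ k ∈ Y n, |lam n k - laminf j| < r
  near : ∀ B ≥ 0, ∀ r > 0, ∀ᶠ n in atTop, ∀ k ∈ Y n, |lam n k| ≤ B →
    ∃ j ∈ Yinf, |laminf j - lam n k| < r

/-- Upper bound: some `lam n k` is close to `laminf (j + 1)`, which forces `m n < k`, so `m n + 1`
is an index and `lam n (m n + 1) ≤ lam n k`. Lower bound: `lam n (m n + 1)` is close to some `laminf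
i`, and the gap `d` forces `i > j`, so `laminf i ≥ laminf (j + 1)`. -/
theorem LocallyConverges.tendsto_succ (hc : LocallyConverges Y lam Yinf laminf)
    (hY : ∀ n, (Y n).OrdConnected) (hlam : ∀ n, StrictMonoOn (lam n) (Y n))
    (hlaminf : StrictMonoOn laminf Yinf) {m : ℕ → ℤ} {d : ℝ} (hd : 0 < d)
    (hgap : ∀ n, m n ∈ Y n → m n + 1 ∈ Y n → d < lam n (m n + 1) - lam n (m n))
    {j : ℤ} (hj : j ∈ Yinf) (hj1 : j + 1 ∈ Yinf) (hm : ∀ᶠ n in atTop, m n ∈ Y n)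
    (ht : Tendsto (fun n => lam n (m n)) atTop (𝓝 (laminf j))) :
    (∀ᶠ n in atTop, m n + 1 ∈ Y n) ∧
      Tendsto (fun n => lam n (m n + 1)) atTop (𝓝 (laminf (j + 1))) := by
  have hlt : laminf j < laminf (j + 1) := hlaminf hj hj1 (lt_add_one j)
  have key : ∀ r > 0, ∀ᶠ n in atTop, m n + 1 ∈ Y n ∧ |lam n (m n + 1) - laminf (j + 1)| < r := by
    intro r hr
    -- Each inequality loses `ρ` twice: `d / 2` secures `i > j`, and half the limiting gap secures
    -- `m n < k`.
    obtain ⟨ρ, hρ0, hρ⟩ : ∃ ρ > 0, ρ ≤ min r (min (d / 2) ((laminf (j + 1) - laminf j) / 2)) :=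
      ⟨_, lt_min hr (lt_min (by linarith) (by linarith)), le_rfl⟩
    simp only [le_min_iff] at hρ
    obtain ⟨hρ1, hρ2, hρ3⟩ := hρ
    filter_upwards [hm, Metric.tendsto_nhds.1 ht ρ hρ0, hc.exists_near _ hj1 ρ hρ0,
      hc.near (|laminf j| + |laminf (j + 1)| + ρ) (by positivity) ρ hρ0] with n h1 h2 h3 h4
    rw [Real.dist_eq, abs_lt] at h2
    obtain ⟨k, hk, h3⟩ := h3
    rw [abs_lt] at h3
    have hmk : m n < k := ((hlam n).lt_iff_lt h1 hk).1 (by linarith)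
    have hm1 : m n + 1 ∈ Y n := (hY n).out h1 hk ⟨by omega, by omega⟩
    have hle : lam n (m n + 1) ≤ lam n k := (hlam n).monotoneOn hm1 hk (by omega)
    have hg := hgap n h1 hm1
    obtain ⟨i, hi, h4⟩ := h4 _ hm1 (by
      rw [abs_le]
      constructor <;> linarith [neg_abs_le (laminf j), abs_nonneg (laminf j),
        le_abs_self (laminf (j + 1)), abs_nonneg (laminf (j + 1))])
    rw [abs_lt] at h4
    have hji : j < i := (hlaminf.lt_iff_lt hj hi).1 (by linarith)
    have := hlaminf.monotoneOn hj1 hi (by omega)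
    refine ⟨hm1, abs_lt.2 ⟨by linarith, by linarith⟩⟩
  exact ⟨(key 1 one_pos).mono fun n h => h.1,
    Metric.tendsto_nhds.2 fun r hr => (key r hr).mono fun n h => h.2⟩

/-- The reflection `k ↦ -k`, `λ ↦ -λ` preserves the hypotheses and exchanges predecessor and
successor. -/
theorem LocallyConverges.tendsto_pred (hc : LocallyConverges Y lam Yinf laminf)
    (hY : ∀ n, (Y n).OrdConnected) (hlam : ∀ n, StrictMonoOn (lam n) (Y n))
    (hlaminf : StrictMonoOn laminf Yinf) {m : ℕ → ℤ} {d : ℝ} (hd : 0 < d)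
    (hgap : ∀ n, m n - 1 ∈ Y n → m n ∈ Y n → d < lam n (m n) - lam n (m n - 1))
    {j : ℤ} (hj : j ∈ Yinf) (hj1 : j - 1 ∈ Yinf) (hm : ∀ᶠ n in atTop, m n ∈ Y n)
    (ht : Tendsto (fun n => lam n (m n)) atTop (𝓝 (laminf j))) :
    (∀ᶠ n in atTop, m n - 1 ∈ Y n) ∧
      Tendsto (fun n => lam n (m n - 1)) atTop (𝓝 (laminf (j - 1))) := by
  have hc' : LocallyConverges (fun n => {k | -k ∈ Y n}) (fun n k => -lam n (-k))
      {k | -k ∈ Yinf} (fun k => -laminf (-k)) := by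
    constructor
    · intro i hi r hr
      filter_upwards [hc.exists_near (-i) hi r hr] with n hn
      obtain ⟨k, hk, h⟩ := hn
      exact ⟨-k, by simpa using hk, by rwa [neg_neg, neg_sub_neg, abs_sub_comm]⟩
    · intro B hB r hr
      filter_upwards [hc.near B hB r hr] with n hn k hk hkB
      obtain ⟨i, hi, h⟩ := hn (-k) hk (by rwa [abs_neg] at hkB)
      exact ⟨-i, by simpa using hi, by rwa [neg_neg, neg_sub_neg, abs_sub_comm]⟩
  have hmono : ∀ {f : ℤ → ℝ} {s : Set ℤ}, StrictMonoOn f s →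
      StrictMonoOn (fun k => -f (-k)) {k | -k ∈ s} := fun hf a ha b hb hab =>
    neg_lt_neg (hf hb ha (neg_lt_neg hab))
  have := hc'.tendsto_succ (m := fun n => -m n) (d := d) (j := -j)
    (fun n => ⟨fun a ha b hb x hx => (hY n).out hb ha ⟨neg_le_neg hx.2, neg_le_neg hx.1⟩⟩)
    (fun n => hmono (hlam n)) (hmono hlaminf) hd
    (fun n h1 h2 => by
      have e : -(-m n + 1) = m n - 1 := by ring
      simp only [Set.mem_ofPred_eq, e, neg_neg] at h1 h2 ⊢
      linarith [hgap n h2 h1])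
    (by simpa using hj) (by simpa [sub_eq_neg_add] using hj1) (by simpa using hm)
    (by simpa using ht.neg)
  have e : ∀ a : ℤ, -(-a + 1) = a - 1 := fun a => by ring
  simp only [Set.mem_ofPred_eq, e] at this
  exact ⟨this.1, by simpa using this.2.neg⟩

/-- If the base indices converge and consecutive gaps are uniformly bounded below, then all indices
converge. -/
theorem LocallyConverges.tendsto_sub (hc : LocallyConverges Y lam Yinf laminf)
    (hY : ∀ n, (Y n).OrdConnected) (hlam : ∀ n, StrictMonoOn (lam n) (Y n))
    (hYinf : Yinf.OrdConnected) (h0 : 0 ∈ Yinf) (hlaminf : StrictMonoOn laminf Yinf)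
    {δ : ℤ → ℝ} (hδ : ∀ j, 0 < δ j)
    (hgap : ∀ (n : ℕ) (j : ℤ), j ∈ Y n → j + 1 ∈ Y n → δ j < lam n (j + 1) - lam n j)
    {s : ℕ → ℤ} (hs : ∀ n, s n = 0 ∨ s n = 1) (hbase : ∀ᶠ n in atTop, -s n ∈ Y n)
    (ht : Tendsto (fun n => lam n (-s n)) atTop (𝓝 (laminf 0))) :
    ∀ j ∈ Yinf, (∀ᶠ n in atTop, j - s n ∈ Y n) ∧
      Tendsto (fun n => lam n (j - s n)) atTop (𝓝 (laminf j)) := by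
  -- The shifted index `j - s n` takes only the values `j` and `j - 1`, so a gap independent of `n`
  -- survives.
  have hgap' : ∀ (n : ℕ) (j : ℤ), j - s n ∈ Y n → j - s n + 1 ∈ Y n →
      min (δ j) (δ (j - 1)) < lam n (j - s n + 1) - lam n (j - s n) := by
    intro n j h1 h2
    refine lt_of_le_of_lt ?_ (hgap n _ h1 h2)
    rcases hs n with h | h <;> rw [h]
    · simp
    · exact min_le_right _ _
  intro j
  induction j using Int.induction_on with
  | zero => exact fun _ => ⟨by simpa using hbase, by simpa using ht⟩
  | succ i ih =>
    intro hi
    have hi' : (i : ℤ) ∈ Yinf := hYinf.out h0 hi ⟨by omega, by omega⟩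
    obtain ⟨h1, h2⟩ := ih hi'
    have e : ∀ n, (i : ℤ) + 1 - s n = i - s n + 1 := fun n => by ring
    simp only [e]
    exact hc.tendsto_succ hY hlam hlaminf (lt_min (hδ _) (hδ _)) (fun n => hgap' n i) hi' hi h1 h2
  | pred i ih =>
    intro hi
    have hi' : (-i : ℤ) ∈ Yinf := hYinf.out hi h0 ⟨by omega, by omega⟩
    obtain ⟨h1, h2⟩ := ih hi'
    have e : ∀ n, -(i : ℤ) - 1 - s n = -i - s n - 1 := fun n => by ring
    simp only [e]
    refine hc.tendsto_pred hY hlam hlaminf (lt_min (hδ (-i - 1)) (hδ (-i - 1 - 1)))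
      (fun n h3 h4 => ?_) hi' hi h1 h2
    have e' : -(i : ℤ) - s n = -i - s n - 1 + 1 := by ring
    have := hgap' n (-i - 1)
    simp only [e] at this
    rw [← e'] at this
    exact this h3 h4

variable {E : Type v} [NormedAddCommGroup E] [InnerProductSpace ℂ E] {D : E →ₗ.[ℂ] E}

theorem IsSpectrumIndexing.mem_opSpectrum_iff {Y : Set ℤ} {lam : ℤ → ℝ}
    (h : IsSpectrumIndexing D Y lam) {x : ℝ} :
    (x : ℂ) ∈ opSpectrum D ↔ ∃ j ∈ Y, lam j = x := by
  rw [← h.image_eq]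
  simp

theorem IsSpectrumIndexing.nonneg_iff {Y : Set ℤ} {lam : ℤ → ℝ}
    (h : IsSpectrumIndexing D Y lam) {j : ℤ} (hj : j ∈ Y) : 0 ≤ lam j ↔ 0 ≤ j := by
  constructor
  · intro h0
    exact (h.strictMonoOn.le_iff_le h.zero_mem hj).1
      (h.isLeast.2 ⟨h.mem_opSpectrum_iff.2 ⟨j, hj, rfl⟩, h0⟩)
  · intro h0
    exact h.isLeast.1.2.trans (h.strictMonoOn.monotoneOn h.zero_mem hj h0)

end Indexing

theorem locallyConverges_of_tendsto_spectralPropinquity {F K G H : ℝ}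
    {T : ℕ → SpectralTriple.{u, v}} {Tinf : SpectralTriple.{u, v}}
    (hconv : Tendsto (fun n => spectralPropinquity.{u, v, w} F K G H (T n) Tinf) atTop (𝓝 0))
    {Y : ℕ → Set ℤ} {lam : ℕ → ℤ → ℝ} {Yinf : Set ℤ} {laminf : ℤ → ℝ}
    (hlam : ∀ n, IsSpectrumIndexing (T n).D (Y n) (lam n))
    (hlaminf : IsSpectrumIndexing Tinf.D Yinf laminf) :
    LocallyConverges Y lam Yinf laminf := by
  constructor
  · intro j hj r hr
    obtain ⟨ε₀, hε₀, h⟩ := exists_spectrum_close.{u, v, w} F K G H (abs_nonneg (laminf j)) hr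
    filter_upwards [hconv.eventually_lt_const hε₀] with n hn
    obtain ⟨ν, hν, hmem⟩ := (h _ _ hn).2 _ le_rfl (hlaminf.mem_opSpectrum_iff.2 ⟨j, hj, rfl⟩)
    obtain ⟨k, hk, rfl⟩ := (hlam n).mem_opSpectrum_iff.1 hmem
    exact ⟨k, hk, hν⟩
  · intro B hB r hr
    obtain ⟨ε₀, hε₀, h⟩ := exists_spectrum_close.{u, v, w} F K G H hB hr
    filter_upwards [hconv.eventually_lt_const hε₀] with n hn k hk hkB
    obtain ⟨ν, hν, hmem⟩ := (h _ _ hn).1 _ hkB ((hlam n).mem_opSpectrum_iff.2 ⟨k, hk, rfl⟩)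
    obtain ⟨j, hj, rfl⟩ := hlaminf.mem_opSpectrum_iff.1 hmem
    exact ⟨j, hj, hν⟩

/-! ### Locating the base index. -/

section Base

variable {E : ℕ → Type v} [∀ n, NormedAddCommGroup (E n)] [∀ n, InnerProductSpace ℂ (E n)]
  {D : ∀ n, E n →ₗ.[ℂ] E n} {Einf : Type v} [NormedAddCommGroup Einf] [InnerProductSpace ℂ Einf]
  {Dinf : Einf →ₗ.[ℂ] Einf} {Y : ℕ → Set ℤ} {lam : ℕ → ℤ → ℝ} {Yinf : Set ℤ} {laminf : ℤ → ℝ}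

/-- The limit spectrum avoids some interval `(-η, η)`. Eigenvalues close to `laminf 0 ≥ η` are
therefore nonnegative and bound `lam n 0` from above. Conversely `lam n 0 ≥ 0` cannot be within `η`
of a negative limit eigenvalue, so it is close to one that is at least `laminf 0`. -/
theorem LocallyConverges.tendsto_zero_of_notMem [CompleteSpace Einf]
    (hc : LocallyConverges Y lam Yinf laminf) (hlam : ∀ n, IsSpectrumIndexing (D n) (Y n) (lam n))
    (hlaminf : IsSpectrumIndexing Dinf Yinf laminf) (h0 : (0 : ℂ) ∉ opSpectrum Dinf) :
    Tendsto (fun n => lam n 0) atTop (𝓝 (laminf 0)) := by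
  obtain ⟨η, hη, hball⟩ := Metric.isOpen_iff.1 (isOpen_compl_opSpectrum Dinf) 0 h0
  have hfar : ∀ i ∈ Yinf, η ≤ |laminf i| := by
    intro i hi
    by_contra! hlt
    exact hball (show (laminf i : ℂ) ∈ Metric.ball 0 η by simpa using hlt)
      (hlaminf.mem_opSpectrum_iff.2 ⟨i, hi, rfl⟩)
  have hnn : 0 ≤ laminf 0 := hlaminf.isLeast.1.2
  have hpos : η ≤ laminf 0 := by simpa [abs_of_nonneg hnn] using hfar 0 hlaminf.zero_mem
  refine Metric.tendsto_nhds.2 fun r hr => ?_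
  obtain ⟨ρ, hρ0, hρ⟩ : ∃ ρ > 0, ρ ≤ min r η := ⟨_, lt_min hr hη, le_rfl⟩
  obtain ⟨hρ1, hρ2⟩ := le_min_iff.1 hρ
  filter_upwards [hc.exists_near 0 hlaminf.zero_mem ρ hρ0,
    hc.near (laminf 0 + ρ) (by positivity) ρ hρ0] with n h1 h2
  obtain ⟨k, hk, h1⟩ := h1
  rw [abs_lt] at h1
  have hk0 : 0 ≤ k := ((hlam n).nonneg_iff hk).1 (by linarith)
  have hle := (hlam n).strictMonoOn.monotoneOn (hlam n).zero_mem hk hk0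
  have hn0 : 0 ≤ lam n 0 := (hlam n).isLeast.1.2
  obtain ⟨i, hi, h2⟩ := h2 0 (hlam n).zero_mem (by rw [abs_of_nonneg hn0]; linarith)
  rw [abs_lt] at h2
  have hi0 : 0 ≤ laminf i := by
    by_contra! hlt
    have := hfar i hi
    rw [abs_of_neg hlt] at this
    linarith
  have := hlaminf.strictMonoOn.monotoneOn hlaminf.zero_mem hi ((hlaminf.nonneg_iff hi).1 hi0)
  rw [Real.dist_eq, abs_lt]
  constructor <;> linarith

theorem LocallyConverges.exists_tendsto_zero_of_mem
    (hc : LocallyConverges Y lam Yinf laminf) (hlam : ∀ n, IsSpectrumIndexing (D n) (Y n) (lam n))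
    (h0 : 0 ∈ Yinf) (hl0 : laminf 0 = 0) :
    ∃ s : ℕ → ℤ, (∀ n, s n = 0 ∨ s n = 1) ∧ (∀ n, -s n ∈ Y n) ∧
      Tendsto (fun n => lam n (-s n)) atTop (𝓝 0) := by
  classical
  -- The choice picks the index among `0` and `-1` whose eigenvalue is closer to `0`. Any eigenvalue
  -- near `0` has one of these two between itself and `0` (or equals it), so the chosen one is at
  -- least as near.
  let s : ℕ → ℤ := fun n => if -1 ∈ Y n ∧ |lam n (-1)| < |lam n 0| then 1 else 0
  refine ⟨s, fun n => ?_, fun n => ?_, Metric.tendsto_nhds.2 fun r hr => ?_⟩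
  · dsimp only [s]
    split_ifs <;> simp
  · dsimp only [s]
    split_ifs with h
    · exact h.1
    · simpa using (hlam n).zero_mem
  filter_upwards [hc.exists_near 0 h0 r hr] with n hn
  obtain ⟨k, hk, hkr⟩ := hn
  rw [hl0, sub_zero] at hkr
  rw [Real.dist_eq, sub_zero]
  rcases le_or_gt 0 k with hk0 | hk0
  · have h1 : |lam n 0| < r := by
      rw [abs_of_nonneg (hlam n).isLeast.1.2]
      exact ((hlam n).strictMonoOn.monotoneOn (hlam n).zero_mem hk hk0).trans_lt
        ((le_abs_self _).trans_lt hkr)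
    dsimp only [s]
    split_ifs with h
    · exact h.2.trans h1
    · simpa using h1
  · have hm1 : -1 ∈ Y n := (hlam n).ordConnected.out hk (hlam n).zero_mem ⟨by omega, by omega⟩
    have h1 : |lam n (-1)| < r := by
      have hneg : lam n (-1) < 0 := by
        rw [← not_le, (hlam n).nonneg_iff hm1]
        decide
      rw [abs_of_neg hneg]
      have := (hlam n).strictMonoOn.monotoneOn hk hm1 (by omega)
      linarith [neg_abs_le (lam n k)]
    dsimp only [s]
    split_ifs with h
    · exact h1
    · have := not_lt.1 fun h2 => h ⟨hm1, h2⟩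
      simpa using this.trans_lt h1

end Base

end SpectralPropinquity

/-! ### Assembling the two cases. -/

theorem mainTheorem7
    (F K G H : ℝ) (hF : 1 ≤ F) (hK : 0 ≤ K) (hG : 1 ≤ G) (hH : 2 ≤ H)
    (T : ℕ → SpectralPropinquity.SpectralTriple.{u, v})
    (Tinf : SpectralPropinquity.SpectralTriple.{u, v})
    (hT : ∀ n, (T n).IsMetric F K) (hTinf : Tinf.IsMetric F K)
    (hconv : Tendsto
      (fun n => SpectralPropinquity.spectralPropinquity.{u, v, w} F K G H (T n) Tinf)
      atTop (𝓝 0))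
    (Y : ℕ → Set ℤ) (lam : ℕ → ℤ → ℝ) (Yinf : Set ℤ) (laminf : ℤ → ℝ)
    (hlam : ∀ n, SpectralPropinquity.IsSpectrumIndexing (T n).D (Y n) (lam n))
    (hlaminf : SpectralPropinquity.IsSpectrumIndexing Tinf.D Yinf laminf)
    (δ : ℤ → ℝ) (hδ : ∀ j, 0 < δ j)
    (hgap : ∀ (n : ℕ) (j : ℤ), j ∈ Y n → j + 1 ∈ Y n → δ j < lam n (j + 1) - lam n j) :
    ((0 : ℂ) ∉ SpectralPropinquity.opSpectrum Tinf.D →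
      ∀ j ∈ Yinf, (∀ᶠ n in atTop, j ∈ Y n) ∧
        Tendsto (fun n => lam n j) atTop (𝓝 (laminf j))) ∧
    ((0 : ℂ) ∈ SpectralPropinquity.opSpectrum Tinf.D →
      laminf 0 = 0 ∧
      (∃ s : ℕ → ℤ, (∀ n, s n = 0 ∨ s n = 1) ∧
        ∀ j ∈ Yinf, (∀ᶠ n in atTop, j - s n ∈ Y n) ∧
          Tendsto (fun n => lam n (j - s n)) atTop (𝓝 (laminf j))) ∧
      (Tendsto (fun n => lam n 0) atTop (𝓝 0) →
        ∀ j ∈ Yinf, (∀ᶠ n in atTop, j ∈ Y n) ∧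
          Tendsto (fun n => lam n j) atTop (𝓝 (laminf j))) ∧
      ((∀ᶠ n in atTop, (-1 : ℤ) ∈ Y n) → Tendsto (fun n => lam n (-1)) atTop (𝓝 0) →
        ∀ j ∈ Yinf, (∀ᶠ n in atTop, j - 1 ∈ Y n) ∧
          Tendsto (fun n => lam n (j - 1)) atTop (𝓝 (laminf j)))) := by
  have hc := SpectralPropinquity.locallyConverges_of_tendsto_spectralPropinquity.{u, v, w}
    hconv hlam hlaminf
  have main := fun (s : ℕ → ℤ) => hc.tendsto_sub (s := s) (fun n => (hlam n).ordConnected)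
    (fun n => (hlam n).strictMonoOn) hlaminf.ordConnected hlaminf.zero_mem hlaminf.strictMonoOn
    hδ hgap
  have main0 : Tendsto (fun n => lam n 0) atTop (𝓝 (laminf 0)) →
      ∀ j ∈ Yinf, (∀ᶠ n in atTop, j ∈ Y n) ∧
        Tendsto (fun n => lam n j) atTop (𝓝 (laminf j)) := fun h => by
    simpa using main (fun _ => 0) (fun _ => Or.inl rfl)
      (Eventually.of_forall fun n => by simpa using (hlam n).zero_mem) (by simpa using h)
  refine ⟨fun h0 => main0 (hc.tendsto_zero_of_notMem hlam hlaminf h0), fun h0 => ?_⟩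
  -- Here `0` is itself a nonnegative spectral value, so the least one is at most `0`.
  have hl0 : laminf 0 = 0 :=
    le_antisymm (hlaminf.isLeast.2 ⟨by simpa using h0, le_rfl⟩) hlaminf.isLeast.1.2
  refine ⟨hl0, ?_, fun h => main0 (by rwa [hl0]), fun hm h => ?_⟩
  · obtain ⟨s, hs, hmem, hs0⟩ := hc.exists_tendsto_zero_of_mem hlam hlaminf.zero_mem hl0
    exact ⟨s, hs, main s hs (Eventually.of_forall hmem) (by rwa [hl0])⟩
  · exact main (fun _ => 1) (fun _ => Or.inr rfl) hm (by rwa [hl0])
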